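/- Let $\beta:\mathbb{R}\to\mathbb{R}$ be continuous with $\beta(x)=0$ for $x\le 0$, $\beta(x)=1$ for $x\ge 1$ and $\beta(x)+\beta(1-x)=1$ for $x\in[0,1]$. Let $\psi,\phi$ be the Meyer wavelet and scaling function with profile $\beta$, that is, the inverse Fourier transforms (with $\hat g(\xi)=\int_{\mathbb{R}} g(x)e^{-2\pi i x\xi}\,dx$) of $$\hat\psi(\xi)=\begin{cases}\sin\big[\tfrac{\pi}{2}\beta(3|\xi|-1)\big]e^{i\pi\xi}, & \tfrac13\le|\xi|\le\tfrac23,\\ \cos\big[\tfrac{\pi}{2}\beta(\tfrac{3|\xi|}{2}-1)\big]e^{i\pi\xi}, & \tfrac23\le|\xi|\le\tfrac43,\\ 0, & \text{otherwise,}\end{cases}\qquad \hat\phi(\xi)=\begin{cases}\cos\big[\tfrac{\pi}{2}\beta(3|\xi|-1)\big], & |\xi|\le\tfrac23,\\ 0, & |\xi|>\tfrac23.\end{cases}$$ Let $0<\alpha\le 3/16$. Then the oversampled Meyer system $$\Phi^\alpha=\{2^{j/2}\psi(2^j\cdot-\alpha k)\}_{j\in\{0,1,2,\dots\},\,k\in\mathbb{Z}}\cup\{\phi(\cdot-\alpha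 k)\}_{k\in\mathbb{Z}}$$ does sign retrieval, that is: $\Phi^\alpha$ is a frame of $L^2(\mathbb{R})$ consisting of real-valued functions, and whenever $f,h\in L^2(\mathbb{R})$ are real-valued, $\int_{\mathbb{R}}|f(x)|e^{a|x|}\,dx<\infty$ for some $a>0$, and $|\langle f,\omega\rangle|=|\langle h,\omega\rangle|$ for every $\omega\in\Phi^\alpha$, then $h=f$ or $h=-f$ almost everywhere. -/

import Mathlib

open scoped FourierTransform

/-- A profile going continuously from `0` to `1` on `[0, 1]`, extended by the constants `0` and `1`
outside of `[0, 1]`, with `β x + β (1 - x) = 1` on `[0, 1]`. Continuity is the only regularity asked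
for, so that all smooth (and all `C^k`) profiles are covered. -/
structure IsMeyerProfile (β : ℝ → ℝ) : Prop where
  continuous : Continuous β
  eq_zero : ∀ x ≤ 0, β x = 0
  eq_one : ∀ x, 1 ≤ x → β x = 1
  symm_add : ∀ x ∈ Set.Icc (0 : ℝ) 1, β x + β (1 - x) = 1

/-- The Fourier transform of the Meyer mother wavelet with profile `β`. -/
noncomputable def meyerWaveletHat (β : ℝ → ℝ) (ξ : ℝ) : ℂ :=
  if |ξ| ∈ Set.Icc (1 / 3 : ℝ) (2 / 3) then
    (Real.sin (Real.pi / 2 * β (3 * |ξ| - 1)) : ℂ) * Complex.exp (Complex.I * Real.pi * ξ)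
  else if |ξ| ∈ Set.Icc (2 / 3 : ℝ) (4 / 3) then
    (Real.cos (Real.pi / 2 * β (3 * |ξ| / 2 - 1)) : ℂ) * Complex.exp (Complex.I * Real.pi * ξ)
  else 0

/-- The Fourier transform of the Meyer scaling function with profile `β`. -/
noncomputable def meyerScalingHat (β : ℝ → ℝ) (ξ : ℝ) : ℂ :=
  if |ξ| ≤ 2 / 3 then (Real.cos (Real.pi / 2 * β (3 * |ξ| - 1)) : ℂ) else 0

/-- The Meyer mother wavelet `ψ(x) = ∫ ψ̂(ξ) e^{2πixξ} dξ`. -/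
noncomputable def meyerWavelet (β : ℝ → ℝ) : ℝ → ℂ := 𝓕⁻ (meyerWaveletHat β)

/-- The Meyer scaling function `φ(x) = ∫ φ̂(ξ) e^{2πixξ} dξ`. -/
noncomputable def meyerScaling (β : ℝ → ℝ) : ℝ → ℂ := 𝓕⁻ (meyerScalingHat β)

/-- The oversampled Meyer system: `2^{j/2} ψ(2^j x - α k)` for `j = 0, 1, 2, …` and `k ∈ ℤ`
(left summand of the index set), and `φ(x - α k)` for `k ∈ ℤ` (right summand). -/
noncomputable def meyerSystem (β : ℝ → ℝ) (α : ℝ) : (ℕ × ℤ) ⊕ ℤ → ℝ → ℂ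
  | Sum.inl (j, k) => fun x =>
      (((2 : ℝ) ^ ((j : ℝ) / 2) : ℝ) : ℂ) * meyerWavelet β ((2 : ℝ) ^ j * x - α * k)
  | Sum.inr k => fun x => meyerScaling β (x - α * k)

/-- The inner product `⟨f, w⟩ = ∫ f(x) conj(w(x)) dx` of `L²(ℝ)`. -/
noncomputable def l2Coeff (f w : ℝ → ℂ) : ℂ := ∫ x : ℝ, f x * (starRingEnd ℂ) (w x)

/-- `Ω = (ω i)` is a frame of the complex Hilbert space `L²(ℝ)`. -/
def IsL2Frame {ι : Type*} (ω : ι → ℝ → ℂ) : Prop :=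
  (∀ i, MeasureTheory.MemLp (ω i) 2) ∧
    ∃ A B : ℝ, 0 < A ∧ A ≤ B ∧ ∀ f : ℝ → ℂ, MeasureTheory.MemLp f 2 →
      Summable (fun i => ‖l2Coeff f (ω i)‖ ^ 2) ∧
      A * ∫ x : ℝ, ‖f x‖ ^ 2 ≤ ∑' i, ‖l2Coeff f (ω i)‖ ^ 2 ∧
      ∑' i, ‖l2Coeff f (ω i)‖ ^ 2 ≤ B * ∫ x : ℝ, ‖f x‖ ^ 2

/-- Exponential decay: `∫ |f(x)| e^{a|x|} dx < ∞` for some `a > 0`. -/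
def HasExpDecay (f : ℝ → ℝ) : Prop :=
  ∃ a : ℝ, 0 < a ∧ MeasureTheory.Integrable (fun x : ℝ => |f x| * Real.exp (a * |x|))

/-- `Ω = (ω i)` is a frame of `L²(ℝ)` consisting of real-valued functions, and every exponentially
decaying real-valued `f ∈ L²(ℝ)` is determined, up to a global sign and among all real-valued
functions in `L²(ℝ)`, by its unsigned frame coefficients `|⟨f, ω i⟩|`. -/
structure DoesSignRetrieval {ι : Type*} (ω : ι → ℝ → ℂ) : Prop where
  isFrame : IsL2Frame ω
  realValued : ∀ i x, (ω i x).im = 0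
  unique : ∀ f h : ℝ → ℝ, MeasureTheory.MemLp f 2 → HasExpDecay f → MeasureTheory.MemLp h 2 →
    (∀ i, ‖l2Coeff (fun x => (f x : ℂ)) (ω i)‖ = ‖l2Coeff (fun x => (h x : ℂ)) (ω i)‖) →
    h =ᵐ[MeasureTheory.volume] f ∨ h =ᵐ[MeasureTheory.volume] -f

/-! Write `m_n` for `meyerSymbol β n`. On the Fourier side, the coefficients of `f` at level `n` are
samples of the inverse transform of `f̂ · conj m_n`, which is supported in `|ξ| ≤ R`, and the
sampling step `s` satisfies `4 R s ≤ 1`: twice the Nyquist rate. Parseval on each level, summed by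
the Calderón identity for the `m_n`, gives a tight frame with constant `α⁻¹`.

For sign retrieval, all coefficients are real, so equal moduli mean equal squares. If `P` and `Q`
are the localized functions of `f` and `h`, then `(P - Q)(P + Q)` has band `2R`, so its zero samples
still force it to vanish. Both factors are analytic, hence one of them is zero, and `f̂ = ±ĥ` almost
everywhere on `{m_n ≠ 0}` (`ae_eq_or_ae_eq_neg_of_sq_sample`).

The sign could depend on `n`. But consecutive sets `{m_n ≠ 0}` meet in a nonempty open set, where
opposite signs would make `f̂` vanish. Exponential decay makes `f̂` analytic, so this forces `f =
0`. Otherwise one sign serves all levels (`ae_eq_or_ae_eq_neg_of_chain`), and the `L²` Fourier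
transform is injective. -/

section FourierLemmas

open MeasureTheory Set Filter

/-! ### The Fourier transform on `L¹ ∩ L²` -/

/-- Both transforms have the same integrals against test functions: the `L²` one by its
compatibility with tempered distributions, the `L¹` one by Fubini. -/
theorem MeasureTheory.Lp.fourier_toLp_ae_eq {f : ℝ → ℂ} (h1 : Integrable f) (h2 : MemLp f 2) :
    (𝓕 (h2.toLp f) : Lp ℂ 2 (volume : Measure ℝ)) =ᵐ[volume] 𝓕 f := by
  refine ae_eq_of_integral_contDiff_smul_eq
    ((Lp.memLp _).locallyIntegrable one_le_two)
    (VectorFourier.fourierIntegral_continuous Real.continuous_fourierChar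
      (by exact continuous_inner) h1).locallyIntegrable ?_
  intro g hg hgc
  have hgc' : HasCompactSupport (fun x => (g x : ℂ)) := hgc.comp_left (g := fun r : ℝ => (r : ℂ)) rfl
  have hg' : ContDiff ℝ (⊤ : ℕ∞) (fun x => (g x : ℂ)) := Complex.ofRealCLM.contDiff.comp hg
  set G : SchwartzMap ℝ ℂ := hgc'.toSchwartzMap hg' with hG
  have hGg : ∀ x, G x = (g x : ℂ) := fun x => rfl
  have key := congrArg (fun T => T G) (Lp.fourier_toTemperedDistribution_eq (h2.toLp f))
  simp only [TemperedDistribution.fourier_apply, Lp.toTemperedDistribution_apply] at key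
  have e1 : ∫ x, g x • (𝓕 (h2.toLp f) : Lp ℂ 2 (volume : Measure ℝ)) x
      = ∫ x, G x • (𝓕 (h2.toLp f) : Lp ℂ 2 (volume : Measure ℝ)) x := by
    simp [hGg]
  rw [e1, ← key]
  have e2 : ∫ x, (𝓕 G) x • (h2.toLp f) x = ∫ x, (𝓕 (G : ℝ → ℂ)) x • f x := by
    refine integral_congr_ae ?_
    filter_upwards [h2.coeFn_toLp] with x hx
    rw [hx, SchwartzMap.fourier_coe]
  rw [e2]
  have e3 := VectorFourier.integral_fourierIntegral_smul_eq_flip (μ := (volume : Measure ℝ))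
    (ν := (volume : Measure ℝ)) (L := innerₗ ℝ) Real.continuous_fourierChar
    (by exact continuous_inner) G.integrable h1
  rw [flip_innerₗ] at e3
  refine Eq.trans e3 ?_
  simp only [hGg, smul_eq_mul]
  refine integral_congr_ae (Eventually.of_forall fun x => ?_)
  simp only [Complex.real_smul]
  rfl

theorem MeasureTheory.Lp.fourierInv_toLp_ae_eq {f : ℝ → ℂ} (h1 : Integrable f) (h2 : MemLp f 2) :
    (𝓕⁻ (h2.toLp f) : Lp ℂ 2 (volume : Measure ℝ)) =ᵐ[volume] 𝓕⁻ f := by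
  refine ae_eq_of_integral_contDiff_smul_eq
    ((Lp.memLp _).locallyIntegrable one_le_two)
    (VectorFourier.fourierIntegral_continuous Real.continuous_fourierChar
      (L := -innerₗ ℝ) (by exact continuous_inner.neg) h1).locallyIntegrable ?_
  intro g hg hgc
  have hgc' : HasCompactSupport (fun x => (g x : ℂ)) := hgc.comp_left (g := fun r : ℝ => (r : ℂ)) rfl
  have hg' : ContDiff ℝ (⊤ : ℕ∞) (fun x => (g x : ℂ)) := Complex.ofRealCLM.contDiff.comp hg
  set G : SchwartzMap ℝ ℂ := hgc'.toSchwartzMap hg' with hG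
  have hGg : ∀ x, G x = (g x : ℂ) := fun x => rfl
  have key := congrArg (fun T => T G) (Lp.fourierInv_toTemperedDistribution_eq (h2.toLp f))
  simp only [TemperedDistribution.fourierInv_apply, Lp.toTemperedDistribution_apply] at key
  have e1 : ∫ x, g x • (𝓕⁻ (h2.toLp f) : Lp ℂ 2 (volume : Measure ℝ)) x
      = ∫ x, G x • (𝓕⁻ (h2.toLp f) : Lp ℂ 2 (volume : Measure ℝ)) x := by
    simp [hGg]
  rw [e1, ← key]
  have e2 : ∫ x, (𝓕⁻ G) x • (h2.toLp f) x = ∫ x, (𝓕⁻ (G : ℝ → ℂ)) x • f x := by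
    refine integral_congr_ae ?_
    filter_upwards [h2.coeFn_toLp] with x hx
    rw [hx, SchwartzMap.fourierInv_coe]
  rw [e2]
  have e3 := VectorFourier.integral_fourierIntegral_smul_eq_flip (μ := (volume : Measure ℝ))
    (ν := (volume : Measure ℝ)) (L := -innerₗ ℝ) Real.continuous_fourierChar
    (by exact continuous_inner.neg) G.integrable h1
  have e4 : (-innerₗ ℝ : ℝ →ₗ[ℝ] ℝ →ₗ[ℝ] ℝ).flip = -innerₗ ℝ := by
    ext; simp
  rw [e4] at e3
  refine Eq.trans e3 ?_
  simp only [hGg, smul_eq_mul]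
  refine integral_congr_ae (Eventually.of_forall fun x => ?_)
  simp only [Complex.real_smul]
  rfl

theorem Real.memLp_two_fourierInv {f : ℝ → ℂ} (h1 : Integrable f) (h2 : MemLp f 2) :
    MemLp (𝓕⁻ f) 2 :=
  (memLp_congr_ae (Lp.fourierInv_toLp_ae_eq h1 h2)).1 (Lp.memLp _)

theorem Real.fourierInv_eq_integral_exp (g : ℝ → ℂ) (x : ℝ) :
    𝓕⁻ g x = ∫ ξ : ℝ, Complex.exp (2 * Real.pi * Complex.I * x * ξ) * g ξ := by
  rw [Real.fourierInv_eq']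
  refine integral_congr_ae (Eventually.of_forall fun ξ => ?_)
  simp only [smul_eq_mul]
  congr 2
  simp
  ring

theorem Real.fourierInv_comp_sub (m : ℝ → ℂ) (t x : ℝ) :
    𝓕⁻ (fun ξ : ℝ => Complex.exp (-(2 * Real.pi * Complex.I * t * ξ)) * m ξ) x = 𝓕⁻ m (x - t) := by
  simp only [Real.fourierInv_eq_integral_exp]
  refine integral_congr_ae (Eventually.of_forall fun ξ => ?_)
  simp only
  rw [← mul_assoc, ← Complex.exp_add]
  congr 2
  push_cast
  ring

theorem norm_exp_two_pi_I (t ξ : ℝ) : ‖Complex.exp (2 * Real.pi * Complex.I * t * ξ)‖ = 1 := by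
  rw [show (2 * Real.pi * Complex.I * t * ξ : ℂ) = ((2 * Real.pi * t * ξ : ℝ) : ℂ) * Complex.I by
    push_cast; ring]
  exact Complex.norm_exp_ofReal_mul_I _

theorem norm_exp_neg_two_pi_I (t ξ : ℝ) :
    ‖Complex.exp (-(2 * Real.pi * Complex.I * t * ξ))‖ = 1 := by
  rw [Complex.exp_neg, norm_inv, norm_exp_two_pi_I, inv_one]

/-- The coefficient of `f` against a translate of a function with Fourier transform `m`. -/
theorem l2Coeff_translate {f m : ℝ → ℂ} (hf : MemLp f 2) (h1 : Integrable m) (h2 : MemLp m 2)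
    (t : ℝ) :
    l2Coeff f (fun x => 𝓕⁻ m (x - t)) =
      𝓕⁻ (fun ξ => (𝓕 (hf.toLp f) : Lp ℂ 2 (volume : Measure ℝ)) ξ * (starRingEnd ℂ) (m ξ)) t := by
  set n : ℝ → ℂ := fun ξ : ℝ => Complex.exp (-(2 * Real.pi * Complex.I * t * ξ)) * m ξ with hn
  have hc : Continuous fun ξ : ℝ => Complex.exp (-(2 * Real.pi * Complex.I * t * ξ)) := by fun_prop
  have hnm : AEStronglyMeasurable n volume := hc.aestronglyMeasurable.mul h1.aestronglyMeasurable
  have hnn : ∀ ξ, ‖n ξ‖ = ‖m ξ‖ := fun ξ => by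
    rw [hn, norm_mul, norm_exp_neg_two_pi_I, one_mul]
  have n1 : Integrable n := h1.congr' hnm (Eventually.of_forall fun ξ => (hnn ξ).symm)
  have n2 : MemLp n 2 := h2.congr_norm hnm (Eventually.of_forall fun ξ => (hnn ξ).symm)
  have hw : (fun x => 𝓕⁻ m (x - t)) = 𝓕⁻ n := by
    funext x
    rw [hn, Real.fourierInv_comp_sub]
  rw [hw]
  set W : Lp ℂ 2 (volume : Measure ℝ) := 𝓕⁻ (n2.toLp n)
  have hW : 𝓕 W = n2.toLp n := FourierTransform.fourier_fourierInv_eq _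
  have h := Lp.inner_fourier_eq W (hf.toLp f)
  rw [hW, L2.inner_def, L2.inner_def] at h
  have e1 : l2Coeff f (𝓕⁻ n) = ∫ a, inner ℂ (W a) ((hf.toLp f) a) := by
    refine integral_congr_ae ?_
    filter_upwards [hf.coeFn_toLp, Lp.fourierInv_toLp_ae_eq n1 n2] with x hx hx'
    rw [hx, hx', RCLike.inner_apply]
  rw [e1, ← h, Real.fourierInv_eq_integral_exp]
  refine integral_congr_ae ?_
  filter_upwards [n2.coeFn_toLp] with x hx
  rw [hx, RCLike.inner_apply, hn]
  simp only [map_mul, ← Complex.exp_conj, map_neg, map_ofNat, Complex.conj_ofReal, Complex.conj_I]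
  rw [show -(2 * (Real.pi : ℂ) * -Complex.I * t * x) = 2 * Real.pi * Complex.I * t * x by ring]
  ring

/-! ### Sampling of band-limited functions -/

theorem integrable_of_memLp_two_of_band {g : ℝ → ℂ} {R : ℝ} (h2 : MemLp g 2)
    (hR : ∀ ξ, R < |ξ| → g ξ = 0) : Integrable g := by
  have hs : Function.support g ⊆ Icc (-R) R := fun ξ hξ => by
    by_contra h
    exact hξ (hR ξ (not_le.1 fun h' => h (abs_le.1 h')))
  rw [← integrableOn_iff_integrable_of_support_subset hs]
  exact (h2.restrict _).integrable one_le_two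

/-- Parseval's identity for the samples of a band-limited function. -/
theorem hasSum_sq_norm_fourierInv_sample {g : ℝ → ℂ} {R s : ℝ} (h2 : MemLp g 2)
    (hR : ∀ ξ, R < |ξ| → g ξ = 0) (hs : 0 < s) (hsR : 2 * R * s ≤ 1) :
    HasSum (fun k : ℤ => ‖𝓕⁻ g (s * k)‖ ^ 2) (s⁻¹ * ∫ ξ, ‖g ξ‖ ^ 2) := by
  -- `[-b, b]` is one period of length `s⁻¹`; the rate condition says that it contains the band. The
  -- samples are then, up to the factor `s` and `k ↦ -k`, the Fourier coefficients of `g` on it.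
  set b : ℝ := s⁻¹ / 2 with hb
  have hbpos : 0 < b := by positivity
  have hRb : R ≤ b := by
    rw [hb, ← one_div, div_div, le_div_iff₀ (by positivity)]
    linarith
  have hab : -b < b := by linarith
  have hT : b - -b = s⁻¹ := by rw [hb]; ring
  have hint : ∀ {E : Type} [NormedAddCommGroup E] [NormedSpace ℝ E] (u : ℝ → E),
      (∀ ξ, g ξ = 0 → u ξ = 0) → ∫ ξ in (-b)..b, u ξ = ∫ ξ, u ξ := by
    intro E _ _ u hu
    rw [intervalIntegral.integral_of_le hab.le, ← integral_Icc_eq_integral_Ioc]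
    refine setIntegral_eq_integral_of_forall_compl_eq_zero fun ξ hξ => hu ξ (hR ξ ?_)
    refine lt_of_le_of_lt hRb (not_le.1 fun h' => hξ (abs_le.1 h'))
  have H := hasSum_sq_fourierCoeffOn hab (f := g) (h2.restrict _)
  rw [hT, hint _ (fun ξ h => by simp [h])] at H
  have hco : ∀ k : ℤ, fourierCoeffOn hab g k = s * 𝓕⁻ g (s * ((-k : ℤ) : ℝ)) := by
    intro k
    rw [fourierCoeffOn_eq_integral, hint _ (fun ξ h => by simp [h]),
      Real.fourierInv_eq_integral_exp, hT]
    simp only [one_div, inv_inv, Complex.real_smul]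
    congr 1
    refine integral_congr_ae (Eventually.of_forall fun ξ => ?_)
    simp only [fourier_coe_apply, smul_eq_mul]
    congr 2
    push_cast
    field_simp
  have H' := H.mul_left ((s⁻¹) ^ 2)
  rw [← (Equiv.neg ℤ).hasSum_iff]
  have e1 : ∀ k : ℤ, s⁻¹ ^ 2 * ‖fourierCoeffOn hab g k‖ ^ 2 =
      ‖𝓕⁻ g (s * ((-k : ℤ) : ℝ))‖ ^ 2 := fun k => by
    rw [hco, norm_mul, Complex.norm_real, Real.norm_of_nonneg hs.le]
    field_simp
  have e2 : s⁻¹ ^ 2 * s⁻¹⁻¹ • ∫ ξ, ‖g ξ‖ ^ 2 = s⁻¹ * ∫ ξ, ‖g ξ‖ ^ 2 := by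
    rw [smul_eq_mul]
    field_simp
  rw [e2] at H'
  simp only [e1] at H'
  exact H'

/-! ### Analyticity of Fourier integrals -/

theorem analyticOnNhd_fourierInv {g : ℝ → ℂ} {a : ℝ} (ha : 0 < a)
    (hm : AEStronglyMeasurable g volume)
    (hg : Integrable (fun ξ => Real.exp (a * |ξ|) * ‖g ξ‖)) :
    AnalyticOnNhd ℝ (𝓕⁻ g) univ := by
  -- Since `2πr = a/2`, the kernel on the strip `|Im z| < r` uses only half of the exponential
  -- weight; the other half absorbs the factor `ξ` produced by differentiation.
  set r : ℝ := a / (4 * Real.pi) with hr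
  have hrpos : 0 < r := by positivity
  set S : Set ℂ := Complex.im ⁻¹' Ioo (-r) r with hS
  have hSo : IsOpen S := isOpen_Ioo.preimage Complex.continuous_im
  set F : ℂ → ℝ → ℂ := fun z ξ => Complex.exp (2 * Real.pi * Complex.I * z * ξ) * g ξ with hF
  set F' : ℂ → ℝ → ℂ := fun z ξ =>
    (Complex.exp (2 * Real.pi * Complex.I * z * ξ) * (2 * Real.pi * Complex.I * ξ)) * g ξ with hF'
  have hexp : ∀ z ∈ S, ∀ ξ : ℝ,
      ‖Complex.exp (2 * Real.pi * Complex.I * z * ξ)‖ ≤ Real.exp (a / 2 * |ξ|) := by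
    intro z hz ξ
    rw [Complex.norm_exp]
    refine Real.exp_le_exp.2 ?_
    have e : (2 * Real.pi * Complex.I * z * ξ).re = -(2 * Real.pi * z.im * ξ) := by
      simp
    rw [e]
    have h1 : |z.im| ≤ r := (abs_lt.2 hz).le
    calc -(2 * Real.pi * z.im * ξ) ≤ |2 * Real.pi * z.im * ξ| := neg_le_abs _
      _ = 2 * Real.pi * |z.im| * |ξ| := by
        rw [abs_mul, abs_mul, abs_of_pos Real.two_pi_pos]
      _ ≤ 2 * Real.pi * r * |ξ| := by gcongr
      _ = a / 2 * |ξ| := by rw [hr]; field_simp; ring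
  have hFm : ∀ z, AEStronglyMeasurable (F z) volume := fun z =>
    (Continuous.aestronglyMeasurable (by fun_prop)).mul hm
  have hFm' : ∀ z, AEStronglyMeasurable (F' z) volume := fun z =>
    (Continuous.aestronglyMeasurable (by fun_prop)).mul hm
  have hd : ∀ z ∈ S, DifferentiableAt ℂ (fun z => ∫ ξ, F z ξ) z := by
    intro z hz
    refine (hasDerivAt_integral_of_dominated_loc_of_deriv_le (F' := F')
      (bound := fun ξ => (4 * Real.pi / a) * (Real.exp (a * |ξ|) * ‖g ξ‖))
      (hSo.mem_nhds hz) (Eventually.of_forall hFm) ?_ (hFm' z) ?_ (hg.const_mul _) ?_).2.differentiableAt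
    · refine hg.mono' (hFm z) (Eventually.of_forall fun ξ => ?_)
      rw [hF, norm_mul]
      gcongr
      refine (hexp z hz ξ).trans (Real.exp_le_exp.2 ?_)
      gcongr
      linarith
    · refine Eventually.of_forall fun ξ w hw => ?_
      simp only [hF']
      rw [norm_mul, ← mul_assoc (4 * Real.pi / a)]
      refine mul_le_mul_of_nonneg_right ?_ (norm_nonneg (g ξ))
      rw [norm_mul]
      have e : ‖(2 * Real.pi * Complex.I * ξ : ℂ)‖ = 2 * Real.pi * |ξ| := by
        simp [abs_of_pos Real.pi_pos]
      rw [e]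
      have h3 : a / 2 * |ξ| ≤ Real.exp (a / 2 * |ξ|) := by
        linarith [Real.add_one_le_exp (a / 2 * |ξ|)]
      calc _ ≤ Real.exp (a / 2 * |ξ|) * (2 * Real.pi * |ξ|) := by gcongr; exact hexp w hw ξ
        _ = (4 * Real.pi / a) * (Real.exp (a / 2 * |ξ|) * (a / 2 * |ξ|)) := by
          field_simp; ring
        _ ≤ (4 * Real.pi / a) * (Real.exp (a / 2 * |ξ|) * Real.exp (a / 2 * |ξ|)) := by gcongr
        _ = _ := by rw [← Real.exp_add]; congr 2; ring
    · refine Eventually.of_forall fun ξ w _ => ?_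
      refine HasDerivAt.mul_const ?_ _
      refine HasDerivAt.cexp ?_
      have := ((hasDerivAt_id w).const_mul (2 * Real.pi * Complex.I)).mul_const (ξ : ℂ)
      simpa using this
  have hA : AnalyticOnNhd ℂ (fun z => ∫ ξ, F z ξ) S :=
    DifferentiableOn.analyticOnNhd (fun z hz => (hd z hz).differentiableWithinAt) hSo
  have e : 𝓕⁻ g = (fun z => ∫ ξ, F z ξ) ∘ (fun x : ℝ => (x : ℂ)) := by
    funext x
    rw [Real.fourierInv_eq_integral_exp]
    rfl
  rw [e]
  refine (hA.restrictScalars (𝕜 := ℝ)).comp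
    (fun x _ => Complex.ofRealCLM.analyticAt x) fun x _ => ?_
  simp [hS, hrpos]

theorem analyticOnNhd_fourierInv_of_band {g : ℝ → ℂ} {R : ℝ} (hg : Integrable g)
    (hR : ∀ ξ, R < |ξ| → g ξ = 0) : AnalyticOnNhd ℝ (𝓕⁻ g) univ := by
  refine analyticOnNhd_fourierInv one_pos hg.aestronglyMeasurable ?_
  refine (hg.norm.const_mul (Real.exp R)).mono'
    ((Continuous.aestronglyMeasurable (by fun_prop)).mul hg.norm.aestronglyMeasurable)
    (Eventually.of_forall fun ξ => ?_)
  rw [norm_mul, norm_norm, Real.norm_of_nonneg (Real.exp_pos _).le]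
  by_cases h : R < |ξ|
  · simp [hR ξ h]
  · gcongr
    linarith

end FourierLemmas

/-! ### Recovering a band-limited function from squared samples -/

section SignDichotomy

open MeasureTheory Set Filter

theorem Real.fourierInv_convolution_eq {p q : ℝ → ℂ} (hp : Integrable p) (hq : Integrable q)
    (x : ℝ) :
    𝓕⁻ (convolution p q (ContinuousLinearMap.mul ℂ ℂ) volume) x = 𝓕⁻ p x * 𝓕⁻ q x := by
  simp only [Real.fourierInv_eq_fourier_neg]
  exact Real.fourier_mul_convolution_eq hp hq (-x)

/-- The convolution is integrable, and bounded because `‖p‖‖q‖ ≤ ‖p‖² + ‖q‖²`; a bounded integrable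
function is square integrable. -/
theorem memLp_two_convolution {p q : ℝ → ℂ} (hp1 : Integrable p) (hq1 : Integrable q)
    (hp : MemLp p 2) (hq : MemLp q 2) :
    MemLp (convolution p q (ContinuousLinearMap.mul ℂ ℂ) volume) 2 := by
  have hi : Integrable (convolution p q (ContinuousLinearMap.mul ℂ ℂ) volume) :=
    hp1.integrable_convolution _ hq1
  have hp2 := (memLp_two_iff_integrable_sq_norm hp.1).1 hp
  have hq2 := (memLp_two_iff_integrable_sq_norm hq.1).1 hq
  set C : ℝ := (∫ t, ‖p t‖ ^ 2) + ∫ t, ‖q t‖ ^ 2 with hC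
  have hb : ∀ x, ‖convolution p q (ContinuousLinearMap.mul ℂ ℂ) volume x‖ ≤ C := by
    intro x
    have hq2x : Integrable fun t => ‖q (x - t)‖ ^ 2 := hq2.comp_sub_left x
    have e : C = ∫ t, (‖p t‖ ^ 2 + ‖q (x - t)‖ ^ 2) := by
      rw [integral_add hp2 hq2x, integral_sub_left_eq_self (fun t => ‖q t‖ ^ 2)]
    rw [e, convolution_def]
    refine norm_integral_le_of_norm_le (hp2.add hq2x) (Eventually.of_forall fun t => ?_)
    simp only [ContinuousLinearMap.mul_apply', norm_mul]
    nlinarith [sq_nonneg (‖p t‖ - ‖q (x - t)‖), sq_nonneg (‖p t‖), sq_nonneg (‖q (x - t)‖)]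
  rw [memLp_two_iff_integrable_sq_norm hi.1]
  refine (hi.norm.const_mul C).mono' (hi.1.norm.pow 2) (Eventually.of_forall fun x => ?_)
  rw [Real.norm_of_nonneg (by positivity), sq]
  exact mul_le_mul_of_nonneg_right (hb x) (norm_nonneg _)

theorem convolution_eq_zero_of_band {p q : ℝ → ℂ} {R : ℝ} (hp : ∀ ξ, R < |ξ| → p ξ = 0)
    (hq : ∀ ξ, R < |ξ| → q ξ = 0) (ξ : ℝ) (hξ : 2 * R < |ξ|) :
    convolution p q (ContinuousLinearMap.mul ℂ ℂ) volume ξ = 0 := by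
  rw [convolution_def]
  refine integral_eq_zero_of_ae (Eventually.of_forall fun t => ?_)
  by_cases h : R < |t|
  · simp [hp t h]
  · have : R < |ξ - t| := by linarith [abs_sub_abs_le_abs_sub ξ t]
    simp [hq _ this]

theorem ae_eq_zero_of_fourierInv_eq_zero_of_band {g : ℝ → ℂ} {R s : ℝ} (h2 : MemLp g 2)
    (hR : ∀ ξ, R < |ξ| → g ξ = 0) (hs : 0 < s) (hsR : 2 * R * s ≤ 1)
    (hz : ∀ k : ℤ, 𝓕⁻ g (s * k) = 0) : g =ᵐ[volume] 0 := by
  have h := hasSum_sq_norm_fourierInv_sample h2 hR hs hsR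
  simp only [hz, norm_zero, ne_eq, OfNat.ofNat_ne_zero, not_false_eq_true, zero_pow] at h
  have h0 : ∫ ξ, ‖g ξ‖ ^ 2 = 0 := by
    have := h.unique hasSum_zero
    simpa [hs.ne'] using this
  have := (integral_eq_zero_iff_of_nonneg (fun ξ => by positivity)
    ((memLp_two_iff_integrable_sq_norm h2.1).1 h2)).1 h0
  filter_upwards [this] with ξ hξ
  simpa using hξ

/-- A band-limited function is determined up to sign by the squares of its samples at twice the
Nyquist rate. -/
theorem ae_eq_or_ae_eq_neg_of_sq_sample {g₁ g₂ : ℝ → ℂ} {R s : ℝ} (h₁ : MemLp g₁ 2)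
    (h₂ : MemLp g₂ 2) (hR₁ : ∀ ξ, R < |ξ| → g₁ ξ = 0) (hR₂ : ∀ ξ, R < |ξ| → g₂ ξ = 0)
    (hs : 0 < s) (hsR : 4 * R * s ≤ 1)
    (hsq : ∀ k : ℤ, 𝓕⁻ g₁ (s * k) ^ 2 = 𝓕⁻ g₂ (s * k) ^ 2) :
    g₁ =ᵐ[volume] g₂ ∨ g₁ =ᵐ[volume] -g₂ := by
  have i₁ := integrable_of_memLp_two_of_band h₁ hR₁
  have i₂ := integrable_of_memLp_two_of_band h₂ hR₂
  have hpR : ∀ ξ, R < |ξ| → (g₁ - g₂) ξ = 0 := fun ξ hξ => by simp [hR₁ ξ hξ, hR₂ ξ hξ]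
  have hqR : ∀ ξ, R < |ξ| → (g₁ + g₂) ξ = 0 := fun ξ hξ => by simp [hR₁ ξ hξ, hR₂ ξ hξ]
  have hp := h₁.sub h₂
  have hq := h₁.add h₂
  have ip := i₁.sub i₂
  have iq := i₁.add i₂
  have c₁ : ∀ x : ℝ, Integrable fun ξ : ℝ => Complex.exp (2 * Real.pi * Complex.I * x * ξ) * g₁ ξ :=
    fun x => i₁.bdd_mul (c := 1) (Continuous.aestronglyMeasurable (by fun_prop))
      (Eventually.of_forall fun ξ => (norm_exp_two_pi_I x ξ).le)
  have c₂ : ∀ x : ℝ, Integrable fun ξ : ℝ => Complex.exp (2 * Real.pi * Complex.I * x * ξ) * g₂ ξ :=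
    fun x => i₂.bdd_mul (c := 1) (Continuous.aestronglyMeasurable (by fun_prop))
      (Eventually.of_forall fun ξ => (norm_exp_two_pi_I x ξ).le)
  have fp : ∀ x, 𝓕⁻ (g₁ - g₂) x = 𝓕⁻ g₁ x - 𝓕⁻ g₂ x := fun x => by
    simp only [Real.fourierInv_eq_integral_exp]
    rw [← integral_sub (c₁ x) (c₂ x)]
    simp [mul_sub]
  have fq : ∀ x, 𝓕⁻ (g₁ + g₂) x = 𝓕⁻ g₁ x + 𝓕⁻ g₂ x := fun x => by
    simp only [Real.fourierInv_eq_integral_exp]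
    rw [← integral_add (c₁ x) (c₂ x)]
    simp [mul_add]
  -- Its inverse transform is the difference of the two squares, which vanishes at the samples. The
  -- convolution doubles the band, hence `4 R s ≤ 1` rather than `2 R s ≤ 1`.
  have hu : convolution (g₁ - g₂) (g₁ + g₂) (ContinuousLinearMap.mul ℂ ℂ) volume =ᵐ[volume] 0 := by
    refine ae_eq_zero_of_fourierInv_eq_zero_of_band (memLp_two_convolution ip iq hp hq)
      (convolution_eq_zero_of_band hpR hqR) hs (by linarith) fun k => ?_
    rw [Real.fourierInv_convolution_eq ip iq, fp, fq]
    linear_combination hsq k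
  have hPQ : ∀ x, 𝓕⁻ (g₁ - g₂) x * 𝓕⁻ (g₁ + g₂) x = 0 := fun x => by
    rw [← Real.fourierInv_convolution_eq ip iq, Real.fourierInv_congr_ae hu,
      Real.fourierInv_eq_integral_exp]
    simp
  have hsR' : 2 * R * s ≤ 1 := by linarith
  -- Analytic functions on a connected set have no zero divisors.
  rcases AnalyticOnNhd.eq_zero_or_eq_zero_of_mul_eq_zero (analyticOnNhd_fourierInv_of_band ip hpR)
    (analyticOnNhd_fourierInv_of_band iq hqR) (fun x _ => hPQ x) isPreconnected_univ with h | h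
  · left
    filter_upwards [ae_eq_zero_of_fourierInv_eq_zero_of_band hp hpR hs hsR'
      fun k => h _ (mem_univ _)] with ξ hξ
    exact sub_eq_zero.1 hξ
  · right
    filter_upwards [ae_eq_zero_of_fourierInv_eq_zero_of_band hq hqR hs hsR'
      fun k => h _ (mem_univ _)] with ξ hξ
    exact eq_neg_of_add_eq_zero_left hξ

end SignDichotomy

/-! ### The Meyer filters and their Calderón identity -/

section MeyerSymbols

open MeasureTheory Set Filter Topology

variable {β : ℝ → ℝ}

/-- The angle `π/2 · β(3|ξ| - 1)` from which the Meyer filters are built. -/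
noncomputable def meyerAngle (β : ℝ → ℝ) (ξ : ℝ) : ℝ := Real.pi / 2 * β (3 * |ξ| - 1)

theorem meyerAngle_of_le (hβ : IsMeyerProfile β) {ξ : ℝ} (h : |ξ| ≤ 1 / 3) :
    meyerAngle β ξ = 0 := by
  rw [meyerAngle, hβ.eq_zero _ (by linarith), mul_zero]

theorem meyerAngle_of_ge (hβ : IsMeyerProfile β) {ξ : ℝ} (h : 2 / 3 ≤ |ξ|) :
    meyerAngle β ξ = Real.pi / 2 := by
  rw [meyerAngle, hβ.eq_one _ (by linarith), mul_one]

theorem meyerAngle_neg (ξ : ℝ) : meyerAngle β (-ξ) = meyerAngle β ξ := by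
  simp [meyerAngle]

theorem meyerAngle_half (hβ : IsMeyerProfile β) : meyerAngle β (1 / 2) = Real.pi / 4 := by
  have h := hβ.symm_add (1 / 2) (by norm_num)
  have h' : β (1 / 2) = 1 / 2 := by norm_num at h ⊢; linarith
  rw [meyerAngle, abs_of_pos (by norm_num), show (3 * (1 / 2) - 1 : ℝ) = 1 / 2 by norm_num, h']
  ring

theorem abs_div_two (ξ : ℝ) : |ξ / 2| = |ξ| / 2 := by
  rw [abs_div, abs_of_pos (two_pos : (0 : ℝ) < 2)]

theorem continuous_meyerAngle (hβ : IsMeyerProfile β) : Continuous (meyerAngle β) := by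
  have := hβ.continuous
  unfold meyerAngle
  fun_prop

theorem meyerScalingHat_eq (hβ : IsMeyerProfile β) (ξ : ℝ) :
    meyerScalingHat β ξ = (Real.cos (meyerAngle β ξ) : ℂ) := by
  unfold meyerScalingHat
  split_ifs with h
  · rfl
  · rw [meyerAngle_of_ge hβ (not_le.1 h).le, Real.cos_pi_div_two, Complex.ofReal_zero]

/-- The cosine is `1` for `|ξ| ≤ 2/3` and the sine is `1` for `|ξ| ≥ 2/3`, so one product covers
both bands and vanishes off them. Continuity becomes evident. -/
theorem meyerWaveletHat_eq (hβ : IsMeyerProfile β) (ξ : ℝ) :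
    meyerWaveletHat β ξ = ((Real.sin (meyerAngle β ξ) * Real.cos (meyerAngle β (ξ / 2)) : ℝ) : ℂ) *
      Complex.exp (Complex.I * Real.pi * ξ) := by
  have hdiv := abs_div_two ξ
  unfold meyerWaveletHat
  split_ifs with h₁ h₂
  · rw [meyerAngle_of_le (ξ := ξ / 2) hβ (by linarith [h₁.2]), Real.cos_zero, mul_one]
    rfl
  · rw [meyerAngle_of_ge hβ h₂.1, Real.sin_pi_div_two, one_mul, meyerAngle, hdiv, mul_div_assoc]
  · rcases lt_or_ge |ξ| (1 / 3) with h | h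
    · rw [meyerAngle_of_le hβ h.le]
      simp
    · have h' : 4 / 3 < |ξ| := by
        by_contra h3
        rcases le_total |ξ| (2 / 3) with h4 | h4
        · exact h₁ ⟨h, h4⟩
        · exact h₂ ⟨h4, not_lt.1 h3⟩
      rw [meyerAngle_of_ge (ξ := ξ / 2) hβ (by linarith), Real.cos_pi_div_two]
      simp

theorem norm_exp_I_pi_mul (ξ : ℝ) : ‖Complex.exp (Complex.I * Real.pi * ξ)‖ = 1 := by
  rw [show (Complex.I * Real.pi * ξ : ℂ) = ((Real.pi * ξ : ℝ) : ℂ) * Complex.I by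
    push_cast; ring]
  exact Complex.norm_exp_ofReal_mul_I _

/-- A difference of one function at `ξ / 2` and at `ξ`, so that sums over scales telescope. -/
theorem norm_sq_meyerWaveletHat (hβ : IsMeyerProfile β) (ξ : ℝ) :
    ‖meyerWaveletHat β ξ‖ ^ 2 =
      Real.cos (meyerAngle β (ξ / 2)) ^ 2 - Real.cos (meyerAngle β ξ) ^ 2 := by
  rw [meyerWaveletHat_eq hβ, norm_mul, norm_exp_I_pi_mul, mul_one, Complex.norm_real,
    Real.norm_eq_abs, sq_abs, mul_pow, Real.sin_sq]
  rcases le_total |ξ| (2 / 3) with h | h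
  · rw [meyerAngle_of_le (ξ := ξ / 2) hβ (by rw [abs_div_two]; linarith), Real.cos_zero]
    ring
  · rw [meyerAngle_of_ge hβ h, Real.cos_pi_div_two]
    ring

/-- The Fourier transforms of the generators of the Meyer system: the scaling function at index
`0` and the wavelet dilated to scale `j` at index `j + 1`. -/
noncomputable def meyerSymbol (β : ℝ → ℝ) : ℕ → ℝ → ℂ
  | 0 => meyerScalingHat β
  | j + 1 => fun ξ => ((((2 : ℝ) ^ ((j : ℝ) / 2))⁻¹ : ℝ) : ℂ) * meyerWaveletHat β (ξ / 2 ^ j)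

/-- The sampling steps of the oversampled Meyer system. -/
noncomputable def meyerStep (α : ℝ) : ℕ → ℝ
  | 0 => α
  | j + 1 => α / 2 ^ j

/-- Radii of balls supporting the Meyer symbols. -/
noncomputable def meyerBand : ℕ → ℝ
  | 0 => 4 / 3
  | j + 1 => 4 / 3 * 2 ^ j

theorem meyerStep_pos {α : ℝ} (hα : 0 < α) (n : ℕ) : 0 < meyerStep α n := by
  cases n with
  | zero => exact hα
  | succ j => simp only [meyerStep]; positivity

/-- The source of `3/16`: the dilations cancel and leave `4 · (4/3) · α ≤ 1`. At level `0` the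
radius `4/3` is not sharp, but gives the same condition. -/
theorem meyerBand_mul_meyerStep {α : ℝ} (hα : α ≤ 3 / 16) (n : ℕ) :
    4 * meyerBand n * meyerStep α n ≤ 1 := by
  cases n with
  | zero => simp only [meyerBand, meyerStep]; linarith
  | succ j =>
    simp only [meyerBand, meyerStep]
    have : 4 * (4 / 3 * 2 ^ j) * (α / 2 ^ j) = 16 / 3 * α := by field_simp; ring
    linarith

theorem continuous_meyerSymbol (hβ : IsMeyerProfile β) (n : ℕ) : Continuous (meyerSymbol β n) := by
  have := continuous_meyerAngle hβ
  cases n with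
  | zero =>
    simp only [meyerSymbol, funext (meyerScalingHat_eq hβ)]
    fun_prop
  | succ j =>
    simp only [meyerSymbol, meyerWaveletHat_eq hβ]
    fun_prop

theorem sq_two_rpow_half (j : ℕ) : ((2 : ℝ) ^ ((j : ℝ) / 2)) ^ 2 = 2 ^ j := by
  rw [← Real.rpow_natCast, ← Real.rpow_mul two_pos.le]
  simp

theorem norm_sq_meyerSymbol_succ (hβ : IsMeyerProfile β) (j : ℕ) (ξ : ℝ) :
    ‖meyerSymbol β (j + 1) ξ‖ ^ 2 = (2 ^ j)⁻¹ * (Real.cos (meyerAngle β (ξ / 2 ^ (j + 1))) ^ 2 -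
      Real.cos (meyerAngle β (ξ / 2 ^ j)) ^ 2) := by
  rw [meyerSymbol, norm_mul, mul_pow, norm_sq_meyerWaveletHat hβ, Complex.norm_real,
    Real.norm_eq_abs, sq_abs, inv_pow, sq_two_rpow_half, div_div, ← pow_succ]

theorem norm_sq_meyerSymbol_zero (hβ : IsMeyerProfile β) (ξ : ℝ) :
    ‖meyerSymbol β 0 ξ‖ ^ 2 = Real.cos (meyerAngle β ξ) ^ 2 := by
  rw [meyerSymbol, meyerScalingHat_eq hβ, Complex.norm_real, Real.norm_eq_abs, sq_abs]

theorem norm_meyerSymbol_le (hβ : IsMeyerProfile β) (n : ℕ) (ξ : ℝ) : ‖meyerSymbol β n ξ‖ ≤ 1 := by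
  rw [← abs_of_nonneg (norm_nonneg _), ← sq_le_one_iff_abs_le_one]
  cases n with
  | zero =>
    rw [norm_sq_meyerSymbol_zero hβ]
    exact Real.cos_sq_le_one _
  | succ j =>
    rw [norm_sq_meyerSymbol_succ hβ]
    have h1 : ((2 : ℝ) ^ j)⁻¹ ≤ 1 := inv_le_one_of_one_le₀ (one_le_pow₀ one_le_two)
    have h2 := Real.cos_sq_le_one (meyerAngle β (ξ / 2 ^ (j + 1)))
    have h3 := sq_nonneg (Real.cos (meyerAngle β (ξ / 2 ^ j)))
    have h4 : (0 : ℝ) ≤ ((2 : ℝ) ^ j)⁻¹ := by positivity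
    nlinarith

theorem meyerSymbol_eq_zero_of_band (hβ : IsMeyerProfile β) (n : ℕ) (ξ : ℝ)
    (hξ : meyerBand n < |ξ|) : meyerSymbol β n ξ = 0 := by
  cases n with
  | zero =>
    simp only [meyerBand] at hξ
    rw [meyerSymbol, meyerScalingHat_eq hβ, meyerAngle_of_ge hβ (by linarith),
      Real.cos_pi_div_two, Complex.ofReal_zero]
  | succ j =>
    simp only [meyerBand] at hξ
    have h : 4 / 3 < |ξ / 2 ^ j| := by
      rw [abs_div, abs_of_pos (by positivity : (0 : ℝ) < 2 ^ j), lt_div_iff₀ (by positivity)]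
      exact hξ
    simp only [meyerSymbol]
    rw [meyerWaveletHat_eq hβ, meyerAngle_of_ge (ξ := ξ / 2 ^ j / 2) hβ (by rw [abs_div_two]; linarith),
      Real.cos_pi_div_two]
    simp

/-- The Calderón identity of the Meyer system. -/
theorem hasSum_norm_sq_meyerSymbol (hβ : IsMeyerProfile β) {α : ℝ} (hα : 0 < α) (ξ : ℝ) :
    HasSum (fun n => (meyerStep α n)⁻¹ * ‖meyerSymbol β n ξ‖ ^ 2) α⁻¹ := by
  have hps : ∀ N : ℕ, ∑ n ∈ Finset.range (N + 1), (meyerStep α n)⁻¹ * ‖meyerSymbol β n ξ‖ ^ 2 =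
      α⁻¹ * Real.cos (meyerAngle β (ξ / 2 ^ N)) ^ 2 := by
    intro N
    induction N with
    | zero => simp [norm_sq_meyerSymbol_zero hβ, meyerStep]
    | succ N ih =>
      rw [Finset.sum_range_succ, ih, norm_sq_meyerSymbol_succ hβ, meyerStep]
      field_simp
      ring
  rw [hasSum_iff_tendsto_nat_of_nonneg
    (fun n => mul_nonneg (inv_nonneg.2 (meyerStep_pos hα n).le) (sq_nonneg _)),
    ← tendsto_add_atTop_iff_nat 1]
  have hlim : Tendsto (fun N : ℕ => |ξ| / 2 ^ N) atTop (𝓝 0) := by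
    have := (tendsto_pow_atTop_nhds_zero_of_lt_one (r := (1 / 2 : ℝ)) (by norm_num)
      (by norm_num)).const_mul |ξ|
    simpa [div_eq_mul_inv] using this
  -- The partial sums are eventually constant: once `|ξ| / 2 ^ N < 1/3`, the angle is `0`.
  refine tendsto_const_nhds.congr' ?_
  filter_upwards [hlim.eventually (gt_mem_nhds (show (0 : ℝ) < 1 / 3 by norm_num))] with N hN
  rw [hps, meyerAngle_of_le hβ, Real.cos_zero]
  · ring
  · rw [abs_div, abs_of_pos (by positivity : (0 : ℝ) < 2 ^ N)]
    exact hN.le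

theorem exists_meyerSymbol_ne_zero (hβ : IsMeyerProfile β) (ξ : ℝ) :
    ∃ n, meyerSymbol β n ξ ≠ 0 := by
  by_contra! h
  have := hasSum_norm_sq_meyerSymbol hβ one_pos ξ
  simp only [h, norm_zero, ne_eq, OfNat.ofNat_ne_zero, not_false_eq_true, zero_pow, mul_zero,
    inv_one] at this
  exact zero_ne_one (hasSum_zero.unique this)

/-- The witnesses sit where the relevant angle is `π/4`, so that sine and cosine are both nonzero:
`1/2` for the scaling function and first wavelet, and `2 ^ j` for scales `j` and `j + 1`, whose
rescaled frequencies are `1` and `1/2`. -/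
theorem meyerSymbol_consecutive_ne_zero (hβ : IsMeyerProfile β) (n : ℕ) :
    ∃ ξ, meyerSymbol β n ξ ≠ 0 ∧ meyerSymbol β (n + 1) ξ ≠ 0 := by
  have hs : Real.sin (Real.pi / 4) ≠ 0 := by rw [Real.sin_pi_div_four]; positivity
  have hc : Real.cos (Real.pi / 4) ≠ 0 := by rw [Real.cos_pi_div_four]; positivity
  have hhalf : meyerWaveletHat β (1 / 2) ≠ 0 := by
    rw [meyerWaveletHat_eq hβ, meyerAngle_half hβ, meyerAngle_of_le (ξ := 1 / 2 / 2) hβ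
      (by norm_num), Real.cos_zero, mul_one]
    exact mul_ne_zero (Complex.ofReal_ne_zero.2 hs) (Complex.exp_ne_zero _)
  have hone : meyerWaveletHat β 1 ≠ 0 := by
    rw [meyerWaveletHat_eq hβ, meyerAngle_half hβ, meyerAngle_of_ge (ξ := 1) hβ
      (by norm_num), Real.sin_pi_div_two, one_mul]
    exact mul_ne_zero (Complex.ofReal_ne_zero.2 hc) (Complex.exp_ne_zero _)
  have hpow : ∀ j : ℕ, ((((2 : ℝ) ^ ((j : ℝ) / 2))⁻¹ : ℝ) : ℂ) ≠ 0 := fun j =>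
    Complex.ofReal_ne_zero.2 (by positivity)
  cases n with
  | zero =>
    refine ⟨1 / 2, ?_, mul_ne_zero (hpow 0) ?_⟩
    · rw [meyerSymbol, meyerScalingHat_eq hβ, meyerAngle_half hβ]
      exact Complex.ofReal_ne_zero.2 hc
    · simpa using hhalf
  | succ j =>
    refine ⟨2 ^ j, mul_ne_zero (hpow j) ?_, mul_ne_zero (hpow (j + 1)) ?_⟩
    · rwa [div_self (by positivity)]
    · rwa [pow_succ, div_mul_eq_div_div, div_self (by positivity)]

theorem meyerSymbol_neg (hβ : IsMeyerProfile β) (n : ℕ) (ξ : ℝ) :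
    meyerSymbol β n (-ξ) = (starRingEnd ℂ) (meyerSymbol β n ξ) := by
  cases n with
  | zero => simp [meyerSymbol, meyerScalingHat_eq hβ, meyerAngle_neg, -Complex.ofReal_cos]
  | succ j =>
    simp only [meyerSymbol, meyerWaveletHat_eq hβ, neg_div, meyerAngle_neg, map_mul,
      Complex.conj_ofReal, ← Complex.exp_conj, Complex.conj_I]
    congr 3
    push_cast
    ring

theorem memLp_meyerSymbol (hβ : IsMeyerProfile β) (n : ℕ) (p : ENNReal) :
    MemLp (meyerSymbol β n) p :=
  (continuous_meyerSymbol hβ n).memLp_of_hasCompactSupport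
    (HasCompactSupport.intro (isCompact_Icc (a := -meyerBand n) (b := meyerBand n)) fun ξ hξ =>
      meyerSymbol_eq_zero_of_band hβ n ξ (not_le.1 fun h => hξ (abs_le.1 h)))

theorem integrable_meyerSymbol (hβ : IsMeyerProfile β) (n : ℕ) : Integrable (meyerSymbol β n) :=
  memLp_one_iff_integrable.1 (memLp_meyerSymbol hβ n 1)

theorem fourierInv_im_eq_zero {m : ℝ → ℂ} (hm : ∀ ξ, m (-ξ) = (starRingEnd ℂ) (m ξ)) (x : ℝ) :
    (𝓕⁻ m x).im = 0 := by
  rw [← Complex.conj_eq_iff_im, Real.fourierInv_eq_integral_exp, ← integral_conj,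
    ← integral_neg_eq_self]
  refine integral_congr_ae (Eventually.of_forall fun ξ => ?_)
  simp only [map_mul, hm, Complex.conj_conj, ← Complex.exp_conj, map_ofNat, Complex.conj_ofReal,
    Complex.conj_I]
  congr 2
  push_cast
  ring

theorem fourierInv_meyerSymbol_succ (j : ℕ) (x : ℝ) :
    𝓕⁻ (meyerSymbol β (j + 1)) x =
      (((2 : ℝ) ^ ((j : ℝ) / 2) : ℝ) : ℂ) * meyerWavelet β (2 ^ j * x) := by
  have h := Measure.integral_comp_div (fun η : ℝ =>
    Complex.exp (2 * Real.pi * Complex.I * ((2 ^ j * x : ℝ) : ℂ) * η) * meyerWaveletHat β η)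
    ((2 : ℝ) ^ j)
  rw [← Real.fourierInv_eq_integral_exp, abs_of_pos (by positivity)] at h
  have h2 : (2 : ℝ) ^ ((j : ℝ) / 2) = ((2 : ℝ) ^ ((j : ℝ) / 2))⁻¹ * 2 ^ j := by
    rw [← sq_two_rpow_half]
    field_simp
  rw [meyerWavelet, h2, Complex.ofReal_mul, mul_assoc, ← Complex.real_smul (x := 2 ^ j), ← h,
    ← integral_const_mul, Real.fourierInv_eq_integral_exp]
  refine integral_congr_ae (Eventually.of_forall fun ξ => ?_)
  simp only [meyerSymbol]
  rw [mul_left_comm]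
  congr 3
  push_cast
  field_simp

/-- Pulling the dilation out of `2 ^ j x - α k` turns each scale into the translates of a single
function along a lattice of step `α / 2 ^ j`. -/
theorem meyerSystem_inl (α : ℝ) (j : ℕ) (k : ℤ) :
    meyerSystem β α (Sum.inl (j, k)) =
      fun x => 𝓕⁻ (meyerSymbol β (j + 1)) (x - meyerStep α (j + 1) * k) := by
  funext x
  have e : (2 : ℝ) ^ j * (x - α / 2 ^ j * k) = 2 ^ j * x - α * k := by field_simp
  simp only [fourierInv_meyerSymbol_succ, meyerSystem, meyerStep, e]

theorem meyerSystem_inr (α : ℝ) (k : ℤ) :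
    meyerSystem β α (Sum.inr k) = fun x => 𝓕⁻ (meyerSymbol β 0) (x - meyerStep α 0 * k) := by
  simp only [meyerSystem, meyerSymbol, meyerStep, meyerScaling]

theorem exists_meyerSystem_eq (β : ℝ → ℝ) (α : ℝ) (i : (ℕ × ℤ) ⊕ ℤ) :
    ∃ (n : ℕ) (k : ℤ), meyerSystem β α i =
      fun x => 𝓕⁻ (meyerSymbol β n) (x - meyerStep α n * k) := by
  rcases i with ⟨j, k⟩ | k
  · exact ⟨j + 1, k, meyerSystem_inl α j k⟩
  · exact ⟨0, k, meyerSystem_inr α k⟩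

end MeyerSymbols

/-! ### The tight frame property and propagation of signs -/

section SignRetrieval

open MeasureTheory Set Filter Topology

variable {β : ℝ → ℝ} {α : ℝ}

/-- The Fourier transform of `f` localized by the `n`-th Meyer symbol. -/
noncomputable def meyerLocalized (β : ℝ → ℝ) {f : ℝ → ℂ} (hf : MemLp f 2) (n : ℕ) (ξ : ℝ) : ℂ :=
  (𝓕 (hf.toLp f) : Lp ℂ 2 (volume : Measure ℝ)) ξ * (starRingEnd ℂ) (meyerSymbol β n ξ)

theorem norm_meyerLocalized {f : ℝ → ℂ} (hf : MemLp f 2) (n : ℕ) (ξ : ℝ) :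
    ‖meyerLocalized β hf n ξ‖ =
      ‖(𝓕 (hf.toLp f) : Lp ℂ 2 (volume : Measure ℝ)) ξ‖ * ‖meyerSymbol β n ξ‖ := by
  rw [meyerLocalized, norm_mul, RCLike.norm_conj]

theorem memLp_meyerLocalized (hβ : IsMeyerProfile β) {f : ℝ → ℂ} (hf : MemLp f 2) (n : ℕ) :
    MemLp (meyerLocalized β hf n) 2 := by
  refine (Lp.memLp (𝓕 (hf.toLp f) : Lp ℂ 2 (volume : Measure ℝ))).mono
    ((Lp.aestronglyMeasurable _).mul
      (Complex.continuous_conj.comp (continuous_meyerSymbol hβ n)).aestronglyMeasurable)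
    (Eventually.of_forall fun ξ => ?_)
  change ‖meyerLocalized β hf n ξ‖ ≤ _
  rw [norm_meyerLocalized]
  exact mul_le_of_le_one_right (norm_nonneg _) (norm_meyerSymbol_le hβ n ξ)

theorem meyerLocalized_eq_zero_of_band (hβ : IsMeyerProfile β) {f : ℝ → ℂ} (hf : MemLp f 2)
    (n : ℕ) (ξ : ℝ) (hξ : meyerBand n < |ξ|) : meyerLocalized β hf n ξ = 0 := by
  rw [meyerLocalized, meyerSymbol_eq_zero_of_band hβ n ξ hξ, map_zero, mul_zero]

theorem l2Coeff_meyer (hβ : IsMeyerProfile β) {f : ℝ → ℂ} (hf : MemLp f 2) (n : ℕ) (t : ℝ) :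
    l2Coeff f (fun x => 𝓕⁻ (meyerSymbol β n) (x - t)) = 𝓕⁻ (meyerLocalized β hf n) t :=
  l2Coeff_translate hf (integrable_meyerSymbol hβ n) (memLp_meyerSymbol hβ n 2) t

theorem hasSum_sq_l2Coeff_level (hβ : IsMeyerProfile β) (hα_pos : 0 < α) (hα : α ≤ 3 / 16)
    {f : ℝ → ℂ} (hf : MemLp f 2) (n : ℕ) :
    HasSum (fun k : ℤ =>
        ‖l2Coeff f (fun x => 𝓕⁻ (meyerSymbol β n) (x - meyerStep α n * k))‖ ^ 2)
      (∫ ξ, ‖(𝓕 (hf.toLp f) : Lp ℂ 2 (volume : Measure ℝ)) ξ‖ ^ 2 *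
        ((meyerStep α n)⁻¹ * ‖meyerSymbol β n ξ‖ ^ 2)) := by
  simp only [l2Coeff_meyer hβ hf]
  have h := hasSum_sq_norm_fourierInv_sample (memLp_meyerLocalized hβ hf n)
    (meyerLocalized_eq_zero_of_band hβ hf n) (meyerStep_pos hα_pos n)
    (by linarith [meyerBand_mul_meyerStep hα n])
  rw [← integral_const_mul] at h
  convert h using 1
  refine integral_congr_ae (Eventually.of_forall fun ξ => ?_)
  simp only [norm_meyerLocalized]
  ring

theorem integral_norm_sq_fourier_toLp {f : ℝ → ℂ} (hf : MemLp f 2) :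
    ∫ ξ, ‖(𝓕 (hf.toLp f) : Lp ℂ 2 (volume : Measure ℝ)) ξ‖ ^ 2 = ∫ x, ‖f x‖ ^ 2 := by
  have key := Lp.inner_fourier_eq (hf.toLp f) (hf.toLp f)
  rw [L2.inner_def, L2.inner_def] at key
  simp only [inner_self_eq_norm_sq_to_K] at key
  have e : ∀ u : ℝ → ℂ, ∫ x, ((‖u x‖ : ℂ)) ^ 2 = ((∫ x, ‖u x‖ ^ 2 : ℝ) : ℂ) := fun u => by
    rw [← integral_complex_ofReal]
    simp
  have key' := Complex.ofReal_injective ((e _).symm.trans (key.trans (e _)))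
  rw [key']
  refine integral_congr_ae ?_
  filter_upwards [hf.coeFn_toLp] with x hx
  rw [hx]

theorem hasSum_sq_l2Coeff_meyerSystem (hβ : IsMeyerProfile β) (hα_pos : 0 < α)
    (hα : α ≤ 3 / 16) {f : ℝ → ℂ} (hf : MemLp f 2) :
    HasSum (fun i => ‖l2Coeff f (meyerSystem β α i)‖ ^ 2) (α⁻¹ * ∫ x, ‖f x‖ ^ 2) := by
  set F : ℝ → ℂ := ⇑(𝓕 (hf.toLp f) : Lp ℂ 2 (volume : Measure ℝ)) with hF
  have hFi : Integrable fun ξ => ‖F ξ‖ ^ 2 :=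
    (memLp_two_iff_integrable_sq_norm (Lp.aestronglyMeasurable _)).1 (Lp.memLp _)
  set I : ℕ → ℝ := fun n => ∫ ξ, ‖F ξ‖ ^ 2 * ((meyerStep α n)⁻¹ * ‖meyerSymbol β n ξ‖ ^ 2) with hI
  have hpt : ∀ ξ, HasSum (fun n => ‖F ξ‖ ^ 2 * ((meyerStep α n)⁻¹ * ‖meyerSymbol β n ξ‖ ^ 2))
      (‖F ξ‖ ^ 2 * α⁻¹) := fun ξ => (hasSum_norm_sq_meyerSymbol hβ hα_pos ξ).mul_left _
  have hIsum : HasSum I (α⁻¹ * ∫ x, ‖f x‖ ^ 2) := by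
    rw [← integral_norm_sq_fourier_toLp hf, mul_comm, ← integral_mul_const]
    -- The terms are nonnegative and dominate themselves; by the Calderón identity their sum is `‖F
    -- ξ‖² α⁻¹`, which is integrable.
    refine hasSum_integral_of_dominated_convergence
      (fun n ξ => ‖F ξ‖ ^ 2 * ((meyerStep α n)⁻¹ * ‖meyerSymbol β n ξ‖ ^ 2)) (fun n => ?_)
      (fun n => Eventually.of_forall fun ξ => ?_) (Eventually.of_forall fun ξ => (hpt ξ).summable)
      ?_ (Eventually.of_forall hpt)
    · exact hFi.1.mul (((continuous_meyerSymbol hβ n).norm.pow 2).const_mul _).aestronglyMeasurable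
    · have := meyerStep_pos hα_pos n
      exact (Real.norm_of_nonneg (by positivity)).le
    · simp only [(hpt _).tsum_eq]
      exact hFi.mul_const _
  have hlevel := fun n => hasSum_sq_l2Coeff_level hβ hα_pos hα hf n
  -- Level `0` is the scaling function (`Sum.inr`), level `j + 1` the wavelets of scale `j`
  -- (`Sum.inl`).
  have hIsucc : HasSum (fun j => I (j + 1)) (α⁻¹ * (∫ x, ‖f x‖ ^ 2) - I 0) := by
    rw [hasSum_nat_add_iff]
    simpa using hIsum
  have hinl : HasSum ((fun i => ‖l2Coeff f (meyerSystem β α i)‖ ^ 2) ∘ Sum.inl)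
      (α⁻¹ * (∫ x, ‖f x‖ ^ 2) - I 0) := by
    have hfib : ∀ j : ℕ, HasSum
        (fun k : ℤ => ‖l2Coeff f (meyerSystem β α (Sum.inl (j, k)))‖ ^ 2) (I (j + 1)) := fun j => by
      simp only [meyerSystem_inl]
      exact hlevel (j + 1)
    have hsum : Summable ((fun i => ‖l2Coeff f (meyerSystem β α i)‖ ^ 2) ∘ Sum.inl) := by
      rw [summable_prod_of_nonneg (fun i => by simp only [Function.comp_apply]; positivity)]
      refine ⟨fun j => (hfib j).summable, ?_⟩
      simp only [Function.comp_apply, (hfib _).tsum_eq]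
      exact hIsucc.summable
    rw [(hsum.hasSum.prod_fiberwise hfib).unique hIsucc |>.symm]
    exact hsum.hasSum
  have hinr : HasSum ((fun i => ‖l2Coeff f (meyerSystem β α i)‖ ^ 2) ∘ Sum.inr) (I 0) := by
    simp only [Function.comp_def, meyerSystem_inr]
    exact hlevel 0
  have := hinl.sum hinr
  rwa [sub_add_cancel] at this

theorem memLp_meyerSystem (hβ : IsMeyerProfile β) (i : (ℕ × ℤ) ⊕ ℤ) :
    MemLp (meyerSystem β α i) 2 := by
  obtain ⟨n, k, h⟩ := exists_meyerSystem_eq β α i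
  rw [h]
  exact (Real.memLp_two_fourierInv (integrable_meyerSymbol hβ n)
    (memLp_meyerSymbol hβ n 2)).comp_measurePreserving (measurePreserving_sub_right volume _)

theorem isL2Frame_meyerSystem (hβ : IsMeyerProfile β) (hα_pos : 0 < α) (hα : α ≤ 3 / 16) :
    IsL2Frame (meyerSystem β α) := by
  refine ⟨memLp_meyerSystem hβ, α⁻¹, α⁻¹, inv_pos.2 hα_pos, le_rfl, fun f hf => ?_⟩
  have h := hasSum_sq_l2Coeff_meyerSystem hβ hα_pos hα hf
  exact ⟨h.summable, h.tsum_eq.ge, h.tsum_eq.le⟩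

theorem meyerSystem_im (hβ : IsMeyerProfile β) (i : (ℕ × ℤ) ⊕ ℤ) (x : ℝ) :
    (meyerSystem β α i x).im = 0 := by
  obtain ⟨n, k, h⟩ := exists_meyerSystem_eq β α i
  rw [h]
  exact fourierInv_im_eq_zero (meyerSymbol_neg hβ n) _

theorem l2Coeff_im_eq_zero (f : ℝ → ℝ) {w : ℝ → ℂ} (hw : ∀ x, (w x).im = 0) :
    (l2Coeff (fun x => (f x : ℂ)) w).im = 0 := by
  have e : l2Coeff (fun x => (f x : ℂ)) w = ∫ x, ((f x * (w x).re : ℝ) : ℂ) := by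
    refine integral_congr_ae (Eventually.of_forall fun x => ?_)
    simp only [Complex.conj_eq_iff_im.2 (hw x), Complex.ofReal_mul]
    rw [← Complex.conj_eq_iff_re.1 (Complex.conj_eq_iff_im.2 (hw x))]
    simp
  rw [e, integral_complex_ofReal, Complex.ofReal_im]

theorem sq_eq_sq_of_norm_eq_of_im_eq_zero {z w : ℂ} (hz : z.im = 0) (hw : w.im = 0)
    (h : ‖z‖ = ‖w‖) : z ^ 2 = w ^ 2 := by
  lift z to ℝ using hz
  lift w to ℝ using hw
  rw [Complex.norm_real, Complex.norm_real, Real.norm_eq_abs, Real.norm_eq_abs] at h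
  exact_mod_cast sq_eq_sq_iff_abs_eq_abs z w |>.2 h

/-- Local agreement up to signs on a chain of overlapping supports propagates to global agreement
up to sign, if no nonzero restriction of the function vanishes on an open set. -/
theorem ae_eq_or_ae_eq_neg_of_chain {m : ℕ → ℝ → ℂ} {F H : ℝ → ℂ}
    (hm : ∀ n, Continuous (m n)) (hcov : ∀ ξ, ∃ n, m n ξ ≠ 0)
    (hover : ∀ n, ∃ ξ, m n ξ ≠ 0 ∧ m (n + 1) ξ ≠ 0)
    (hF : ∀ U : Set ℝ, IsOpen U → U.Nonempty → (∀ᵐ ξ, ξ ∈ U → F ξ = 0) → F =ᵐ[volume] 0)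
    (hsign : ∀ n, (∀ᵐ ξ, m n ξ ≠ 0 → F ξ = H ξ) ∨ ∀ᵐ ξ, m n ξ ≠ 0 → F ξ = -H ξ) :
    F =ᵐ[volume] H ∨ F =ᵐ[volume] -H := by
  -- For `F = 0` the overlap argument says nothing, but then `H` vanishes on every level too.
  by_cases hF0 : F =ᵐ[volume] 0
  · left
    have : ∀ n, ∀ᵐ ξ, m n ξ ≠ 0 → H ξ = 0 := fun n => by
      rcases hsign n with h | h <;> filter_upwards [h, hF0] with ξ h₁ h₂ h₃
      · rw [← h₁ h₃, h₂, Pi.zero_apply]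
      · rw [← neg_eq_zero, ← h₁ h₃, h₂, Pi.zero_apply]
    filter_upwards [ae_all_iff.2 this, hF0] with ξ h₁ h₂
    obtain ⟨n, hn⟩ := hcov ξ
    rw [h₁ n hn, h₂, Pi.zero_apply]
  -- `K` will be `H` or `-H`, according to the sign found at level `0`.
  have main : ∀ K : ℝ → ℂ,
      (∀ n, (∀ᵐ ξ, m n ξ ≠ 0 → F ξ = K ξ) ∨ ∀ᵐ ξ, m n ξ ≠ 0 → F ξ = -K ξ) →
      (∀ᵐ ξ, m 0 ξ ≠ 0 → F ξ = K ξ) → F =ᵐ[volume] K := by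
    intro K hK h0
    have hall : ∀ n, ∀ᵐ ξ, m n ξ ≠ 0 → F ξ = K ξ := by
      intro n
      induction n with
      | zero => exact h0
      | succ n ih =>
        -- A change of sign gives `F = K = -F` on the overlap, an open set on which `F` would
        -- vanish.
        refine (hK (n + 1)).resolve_right fun h => hF0 ?_
        refine hF {ξ | m n ξ ≠ 0 ∧ m (n + 1) ξ ≠ 0}
          ((isOpen_ne_fun (hm n) continuous_const).inter
            (isOpen_ne_fun (hm (n + 1)) continuous_const)) (hover n) ?_
        filter_upwards [ih, h] with ξ h₁ h₂ hξ
        exact self_eq_neg.1 ((h₂ hξ.2).trans (congrArg Neg.neg (h₁ hξ.1).symm))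
    filter_upwards [ae_all_iff.2 hall] with ξ hξ
    obtain ⟨n, hn⟩ := hcov ξ
    exact hξ n hn
  rcases hsign 0 with h | h
  · exact Or.inl (main H hsign h)
  · refine Or.inr (main (-H) (fun n => ?_) h)
    simpa [or_comm] using hsign n

theorem HasExpDecay.analyticOnNhd_fourier {f : ℝ → ℝ} (hf : MemLp f 2) (h : HasExpDecay f) :
    Integrable (fun x => (f x : ℂ)) ∧ AnalyticOnNhd ℝ (𝓕 fun x => (f x : ℂ)) univ := by
  obtain ⟨a, ha, hi⟩ := h
  have hm : AEStronglyMeasurable (fun x => (f x : ℂ)) volume :=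
    Complex.continuous_ofReal.comp_aestronglyMeasurable hf.1
  refine ⟨hi.mono' hm (Eventually.of_forall fun x => ?_), ?_⟩
  · rw [Complex.norm_real, Real.norm_eq_abs]
    exact le_mul_of_one_le_right (abs_nonneg _) (Real.one_le_exp (by positivity))
  · have hA := analyticOnNhd_fourierInv ha hm (by simpa [mul_comm] using hi)
    have e : 𝓕 (fun x => (f x : ℂ)) = 𝓕⁻ (fun x => (f x : ℂ)) ∘ fun x => -x := by
      funext x
      rw [Function.comp_apply, Real.fourierInv_eq_fourier_neg, neg_neg]
    rw [e]
    exact hA.comp (fun x _ => analyticAt_id.neg) fun x _ => mem_univ _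

theorem meyerSystem_determines_up_to_sign (hβ : IsMeyerProfile β) (hα_pos : 0 < α)
    (hα : α ≤ 3 / 16) {f h : ℝ → ℝ} (hf : MemLp f 2) (hfd : HasExpDecay f) (hh : MemLp h 2)
    (hc : ∀ i, ‖l2Coeff (fun x => (f x : ℂ)) (meyerSystem β α i)‖ =
      ‖l2Coeff (fun x => (h x : ℂ)) (meyerSystem β α i)‖) :
    h =ᵐ[volume] f ∨ h =ᵐ[volume] -f := by
  have hfC : MemLp (fun x => (f x : ℂ)) 2 := hf.ofReal
  have hhC : MemLp (fun x => (h x : ℂ)) 2 := hh.ofReal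
  obtain ⟨hfi, hfa⟩ := hfd.analyticOnNhd_fourier hf
  set F : Lp ℂ 2 (volume : Measure ℝ) := 𝓕 (hfC.toLp _) with hFdef
  set H : Lp ℂ 2 (volume : Measure ℝ) := 𝓕 (hhC.toLp _) with hHdef
  have hFf : F =ᵐ[volume] 𝓕 fun x => (f x : ℂ) := Lp.fourier_toLp_ae_eq hfi hfC
  have hsq : ∀ (n : ℕ) (k : ℤ), 𝓕⁻ (meyerLocalized β hfC n) (meyerStep α n * k) ^ 2 =
      𝓕⁻ (meyerLocalized β hhC n) (meyerStep α n * k) ^ 2 := by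
    intro n k
    obtain ⟨i, hi⟩ : ∃ i, meyerSystem β α i =
        fun x => 𝓕⁻ (meyerSymbol β n) (x - meyerStep α n * k) := by
      cases n with
      | zero => exact ⟨_, meyerSystem_inr α k⟩
      | succ j => exact ⟨_, meyerSystem_inl α j k⟩
    rw [← l2Coeff_meyer hβ hfC, ← l2Coeff_meyer hβ hhC, ← hi]
    exact sq_eq_sq_of_norm_eq_of_im_eq_zero (l2Coeff_im_eq_zero f (meyerSystem_im hβ i))
      (l2Coeff_im_eq_zero h (meyerSystem_im hβ i)) (hc i)
  have hsign : ∀ n, (∀ᵐ ξ, meyerSymbol β n ξ ≠ 0 → F ξ = H ξ) ∨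
      ∀ᵐ ξ, meyerSymbol β n ξ ≠ 0 → F ξ = -H ξ := by
    intro n
    refine (ae_eq_or_ae_eq_neg_of_sq_sample (memLp_meyerLocalized hβ hfC n)
      (memLp_meyerLocalized hβ hhC n) (meyerLocalized_eq_zero_of_band hβ hfC n)
      (meyerLocalized_eq_zero_of_band hβ hhC n) (meyerStep_pos hα_pos n)
      (meyerBand_mul_meyerStep hα n) (hsq n)).imp (fun h => ?_) (fun h => ?_)
    · filter_upwards [h] with ξ h₁ h₂
      -- Both localizations carry the same factor `conj m_n`, which cancels where it is nonzero.
      exact mul_right_cancel₀ ((map_ne_zero _).2 h₂) h₁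
    · filter_upwards [h] with ξ h₁ h₂
      refine mul_right_cancel₀ ((map_ne_zero (starRingEnd ℂ)).2 h₂) (h₁.trans ?_)
      rw [Pi.neg_apply, meyerLocalized, neg_mul]
  -- Identity theorem for the analytic representative of `F`; the decay of `f` is what provides it,
  -- and `h` need only be in `L²`.
  have hvanish : ∀ U : Set ℝ, IsOpen U → U.Nonempty → (∀ᵐ ξ, ξ ∈ U → F ξ = 0) →
      F =ᵐ[volume] 0 := by
    intro U hU ⟨x, hx⟩ hF
    have hcont : Continuous (𝓕 fun x => (f x : ℂ)) :=
      continuousOn_univ.1 hfa.continuousOn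
    have hEq : EqOn (𝓕 fun x => (f x : ℂ)) 0 U := by
      refine Measure.eqOn_open_of_ae_eq (μ := volume) ?_ hU hcont.continuousOn
        continuousOn_const
      rw [EventuallyEq, ae_restrict_iff' hU.measurableSet]
      filter_upwards [hF, hFf] with ξ h₁ h₂ h₃
      rw [← h₂, h₁ h₃, Pi.zero_apply]
    have hz := hfa.eqOn_zero_of_preconnected_of_eventuallyEq_zero isPreconnected_univ
      (mem_univ x) (hEq.eventuallyEq_of_mem (hU.mem_nhds hx))
    filter_upwards [hFf] with ξ hξ
    rw [hξ, hz (mem_univ ξ)]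
  have hinj : Function.Injective (𝓕 : Lp ℂ 2 (volume : Measure ℝ) → Lp ℂ 2 (volume : Measure ℝ)) :=
    (Lp.fourierTransformₗᵢ ℝ ℂ).injective
  refine (ae_eq_or_ae_eq_neg_of_chain (continuous_meyerSymbol hβ)
    (exists_meyerSymbol_ne_zero hβ) (meyerSymbol_consecutive_ne_zero hβ) hvanish hsign).imp
    (fun e => ?_) (fun e => ?_)
  · have e₁ : hfC.toLp _ = hhC.toLp _ := hinj (Lp.ext e)
    filter_upwards [(MemLp.toLp_eq_toLp_iff hfC hhC).1 e₁] with x hx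
    exact_mod_cast hx.symm
  · have e₀ : F = 𝓕 (-hhC.toLp _) := by
      rw [FourierTransform.fourier_neg]
      exact Lp.ext (e.trans (Lp.coeFn_neg H).symm)
    have e₁ : hfC.toLp _ = -hhC.toLp _ := hinj e₀
    rw [← MemLp.toLp_neg] at e₁
    filter_upwards [(MemLp.toLp_eq_toLp_iff hfC hhC.neg).1 e₁] with x hx
    rw [Pi.neg_apply] at hx
    have : f x = -h x := by exact_mod_cast hx
    simp [this]

end SignRetrieval

theorem theorem6p1 (β : ℝ → ℝ) (hβ : IsMeyerProfile β) (α : ℝ) (hα_pos : 0 < α)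
    (hα : α ≤ 3 / 16) : DoesSignRetrieval (meyerSystem β α) where
  isFrame := isL2Frame_meyerSystem hβ hα_pos hα
  realValued := meyerSystem_im hβ
  unique _ _ hf hfd hh hc := meyerSystem_determines_up_to_sign hβ hα_pos hα hf hfd hh hc
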